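/- Let $n,m\in\mathbb N$, let $\nu>n-1$ be real and let $\Sigma_0\in\mathbb R^{n\times n}$ be symmetric positive definite. For $\nu'>n-1$ and $\Psi$ positive definite, $W^{-1}(\nu',\Psi)$ denotes the Inverse Wishart distribution: the probability measure on the symmetric positive definite $n\times n$ matrices whose density with respect to Lebesgue measure $\prod_{i\le j}dS_{ij}$ is proportional to $\det(S)^{-(\nu'+n+1)/2}\exp\{-\tfrac12\mathrm{Tr}(\Psi S^{-1})\}$. Let the returns satisfy $r_1,\dots,r_m\mid\mu,\Sigma\ \overset{iid}{\sim}\ N_n(\mu,\Sigma)$. (a) Transformed model. Let $P^*\in\mathbb R^{n\times n}$ be invertible, $r_i^*=P^*r_i$, $\mu^*=P^*\mu$, $\Sigma^*=P^*\Sigma {P^*}^T$, and suppose that $\mu^*\sim N_n(q^*,\Omega^*)$ with $\Omega^*$ positive definite, that $\Sigma^*\sim W^{-1}(\nu,\Sigma_0)$, and that $\mu^*$ and $\Sigma^*$ are independent. Then $r_1^*,\dots,r_m^*\mid\mu^*,\Sigma^*\ \overset{iid}{\sim}\ N_n(\mu^*,\Sigma^*)$, and the full conditional distribution of $\Sigma^*$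 is $$\Sigma^*\mid r_1^*,\dots,r_m^*,\mu^*\ \sim\ W^{-1}\Big(\nu+m,\ \Sigma_0+\sum_{i=1}^m(r_i^*-\mu^*)(r_i^*-\mu^*)^T\Big)$$ for almost every value of $(r_1^*,\dots,r_m^*,\mu^*)$. (b) Untransformed model. Let $P\in\mathbb R^{k\times n}$ be any matrix, $q\in\mathbb R^k$, and $\Omega\in\mathbb R^{k\times k}$ positive definite. Suppose that $\Sigma\sim W^{-1}(\nu,\Sigma_0)$ independently of $\mu$, where the prior on $\mu$ is either (i) any probability law with $P\mu\sim N_k(q,\Omega)$, or (ii) the possibly improper prior with Lebesgue density $\exp\{-\tfrac12(P\mu-q)^T\Omega^{-1}(P\mu-q)\}$ on $\mathbb R^n$ (in which case the joint law is a $\sigma$-finite measure and conditional distributions are its disintegrations). Then $$\Sigma\mid r_1,\dots,r_m,\mu\ \sim\ W^{-1}\Big(\nu+m,\ \Sigma_0+\sum_{i=1}^m(r_i-\mu)(r_i-\mu)^T\Big)$$ for almost every value of $(r_1,\dots,r_m,\mu)$. -/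

import Mathlib

open MeasureTheory ProbabilityTheory
open scoped Matrix ENNReal

/-- The product (equivalently, Borel) sigma-algebra on real square matrices. -/
instance squareMatrixMeasurableSpace {n : ℕ} : MeasurableSpace (Matrix (Fin n) (Fin n) ℝ) :=
  inferInstanceAs (MeasurableSpace (Fin n → Fin n → ℝ))

/-- The symmetric matrix whose entries on and above the diagonal are the given numbers. -/
def symmetricOfUpper {n : ℕ} (v : {p : Fin n × Fin n // p.1 ≤ p.2} → ℝ) :
    Matrix (Fin n) (Fin n) ℝ :=
  Matrix.of fun i j => v ⟨(min i j, max i j), min_le_max⟩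

/-- Lebesgue measure `∏_{i ≤ j} dS_{ij}` on symmetric `n × n` matrices, as a measure on all
matrices concentrated on the symmetric ones. -/
noncomputable def symmetricLebesgue (n : ℕ) : Measure (Matrix (Fin n) (Fin n) ℝ) :=
  Measure.map symmetricOfUpper volume

/-- The kernel `det(S)^{-(ν+n+1)/2} exp(-Tr(Ψ S⁻¹)/2)` of the Inverse Wishart density. -/
noncomputable def inverseWishartKernel {n : ℕ} (ν : ℝ) (Ψ S : Matrix (Fin n) (Fin n) ℝ) : ℝ :=
  S.det ^ (-(ν + n + 1) / 2) * Real.exp (-(1 / 2) * (Ψ * S⁻¹).trace)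

/-- The measure on positive definite matrices with density `inverseWishartKernel ν Ψ`. -/
noncomputable def inverseWishartUnnormalized {n : ℕ} (ν : ℝ) (Ψ : Matrix (Fin n) (Fin n) ℝ) :
    Measure (Matrix (Fin n) (Fin n) ℝ) :=
  ((symmetricLebesgue n).restrict {S | S.PosDef}).withDensity
    fun S => ENNReal.ofReal (inverseWishartKernel ν Ψ S)

/-- The Inverse Wishart distribution `W⁻¹(ν, Ψ)` (for `ν > n - 1` and `Ψ` positive definite): the
probability measure on positive definite matrices whose density is proportional to
`det(S)^{-(ν+n+1)/2} exp(-Tr(Ψ S⁻¹)/2)`. -/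
noncomputable def inverseWishart {n : ℕ} (ν : ℝ) (Ψ : Matrix (Fin n) (Fin n) ℝ) :
    Measure (Matrix (Fin n) (Fin n) ℝ) :=
  (inverseWishartUnnormalized ν Ψ Set.univ)⁻¹ • inverseWishartUnnormalized ν Ψ

/-- The joint law of `m` independent `N_n(μ, S)` vectors. -/
noncomputable def normalSample {n : ℕ} (m : ℕ) (μ : EuclideanSpace ℝ (Fin n))
    (S : Matrix (Fin n) (Fin n) ℝ) : Measure (Fin m → EuclideanSpace ℝ (Fin n)) :=
  Measure.pi fun _ => multivariateGaussian μ S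

/-- The scatter matrix `∑ i, (r i - μ) (r i - μ)ᵀ`. -/
def scatterMatrix {n m : ℕ} (r : Fin m → EuclideanSpace ℝ (Fin n))
    (μ : EuclideanSpace ℝ (Fin n)) : Matrix (Fin n) (Fin n) ℝ :=
  ∑ i, Matrix.vecMulVec (r i - μ).ofLp (r i - μ).ofLp

/-- The matrix-vector product on Euclidean spaces. -/
def applyMatrix {k n : ℕ} (P : Matrix (Fin k) (Fin n) ℝ) (x : EuclideanSpace ℝ (Fin n)) :
    EuclideanSpace ℝ (Fin k) :=
  WithLp.toLp 2 (P *ᵥ x.ofLp)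

/-- The (in general improper) prior on `μ` with Lebesgue density
`exp(-(Pμ - q)ᵀ Ω⁻¹ (Pμ - q)/2)`. -/
noncomputable def viewDensityPrior {k n : ℕ} (P : Matrix (Fin k) (Fin n) ℝ)
    (q : EuclideanSpace ℝ (Fin k)) (Ω : Matrix (Fin k) (Fin k) ℝ) :
    Measure (EuclideanSpace ℝ (Fin n)) :=
  (volume : Measure (EuclideanSpace ℝ (Fin n))).withDensity fun μ =>
    ENNReal.ofReal (Real.exp (-(1 / 2) *
      ((applyMatrix P μ - q).ofLp ⬝ᵥ (Ω⁻¹ *ᵥ (applyMatrix P μ - q).ofLp))))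

/-- `Y | X = x ∼ K x`: a regular conditional distribution of `Y` given `X` under `Pr` is given by
`K x` for almost every `x`. `Pr` may be an infinite measure (an improper joint law), as long as the
law of `X` is σ-finite, so that conditional distributions are unique up to null sets. -/
def HasConditionalLaw {Ω α β : Type*} [MeasurableSpace Ω] [MeasurableSpace α] [MeasurableSpace β]
    (Y : Ω → β) (X : Ω → α) (K : α → Measure β) (Pr : Measure Ω) : Prop :=
  SigmaFinite (Pr.map X) ∧
    ∃ κ : Kernel α β, IsMarkovKernel κ ∧ (∀ᵐ x ∂(Pr.map X), κ x = K x) ∧ HasCondDistrib Y X κ Pr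

/-!
The likelihood of `m` independent `N_n(μ, S)` vectors `r i` is a constant times
`det(S)^{-m/2} exp(-Tr(C S⁻¹)/2)`, where `C` is the scatter matrix of the sample about `μ`.
Multiplied by the Inverse Wishart kernel with parameters `(ν, Ψ)` it is a constant multiple of the
kernel with parameters `(ν + m, Ψ + C)`
(`inverseWishartKernel_mul_prod_multivariateGaussianDensity`). By Tonelli's theorem the joint law
of `((r, μ), S)` is therefore the composition of a measure on `(r, μ)`, given by an explicit
density, with the normalized Inverse Wishart kernel
(`lintegral_inverseWishart_lintegral_normalSample`). That kernel is Markov, so the measure on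
`(r, μ)` must be the law of `(r, μ)`, and the kernel is the conditional law of `S`. The argument
works for every `σ`-finite prior on `μ` (`hasConditionalLaw_inverseWishart`), which covers all
three models: in the transformed one, the sample `Q r` is normal given `(Q μ, Q S Qᵀ)`, because
this change of parameters is invertible (`hasConditionalLaw_normalSample_applyMatrix`).

Two facts about the distributions are needed. The multivariate Gaussian measure, defined as the
image of a standard Gaussian under `x ↦ μ + √S x`, has the usual density
(`multivariateGaussian_eq_withDensity`). And the normalizing constant of the Inverse Wishart
kernel is positive and finite for `ν > n - 1` (`isProbabilityMeasure_inverseWishart`). For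
finiteness, `Ψ` is bounded below by a scalar matrix, and the integral is bounded by induction on
`n`: writing a positive definite matrix as `[[c, bᵀ], [b, A]]` with Schur complement
`d = c - bᵀ A⁻¹ b`, its determinant is `d det A` and the trace of its inverse is
`Tr A⁻¹ + |A⁻¹ b|² / d + 1 / d`, so the integral over `b` is Gaussian, the one over `d` is inverse
gamma, and the one over `A` is of the same form with `ν - 1` in place of `ν`.
-/

/-! ### Densities of product measures and Gaussian measures -/

theorem MeasureTheory.Measure.map_withDensity_comp {α β : Type*} [MeasurableSpace α]
    [MeasurableSpace β] (μ : Measure α) {f : α → β} (hf : Measurable f) {h : β → ℝ≥0∞}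
    (hh : Measurable h) :
    (μ.withDensity fun x => h (f x)).map f = (μ.map f).withDensity h := by
  ext s hs
  rw [Measure.map_apply hf hs, withDensity_apply _ (hf hs), withDensity_apply _ hs,
    setLIntegral_map hs hh hf]

theorem lintegral_pi_fin_prod {X : Type*} [MeasurableSpace X] {n : ℕ} (μ : Fin n → Measure X)
    [∀ i, SigmaFinite (μ i)] (f : Fin n → X → ℝ≥0∞) (hf : ∀ i, Measurable (f i)) :
    ∫⁻ x, ∏ i, f i (x i) ∂Measure.pi μ = ∏ i, ∫⁻ x, f i x ∂μ i := by
  induction n with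
  | zero => simp
  | succ n ih =>
    rw [Fin.prod_univ_succ, ← ih (fun i => μ i.succ) (fun i => f i.succ) (fun i => hf _),
      ← lintegral_prod_mul (hf 0).aemeasurable (Finset.measurable_prod _ fun i _ =>
        (hf i.succ).comp (measurable_pi_apply i)).aemeasurable,
      ← ((measurePreserving_piFinSuccAbove μ 0).symm).lintegral_comp_emb
        (MeasurableEquiv.measurableEmbedding _)]
    refine lintegral_congr fun x => ?_
    simp [Fin.prod_univ_succ, MeasurableEquiv.piFinSuccAbove, Fin.insertNthEquiv]

theorem pi_withDensity_fin {X : Type*} [MeasurableSpace X] {n : ℕ} (μ : Measure X)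
    [SigmaFinite μ] (f : Fin n → X → ℝ≥0∞) (hf : ∀ i, Measurable (f i))
    [∀ i, SigmaFinite (μ.withDensity (f i))] :
    Measure.pi (fun i => μ.withDensity (f i)) =
      (Measure.pi fun _ => μ).withDensity fun x => ∏ i, f i (x i) := by
  refine Measure.pi_eq fun s hs => ?_
  rw [withDensity_apply _ (MeasurableSet.univ_pi hs), Measure.restrict_pi_pi,
    lintegral_pi_fin_prod _ _ hf]
  exact Finset.prod_congr rfl fun i _ => (withDensity_apply _ (hs i)).symm

/-- The density of the multivariate Gaussian distribution `N_n(μ, S)`, for positive definite `S`. -/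
noncomputable def multivariateGaussianDensity {n : ℕ} (μ : EuclideanSpace ℝ (Fin n))
    (S : Matrix (Fin n) (Fin n) ℝ) (x : EuclideanSpace ℝ (Fin n)) : ℝ :=
  (√(2 * Real.pi))⁻¹ ^ n * S.det ^ (-(1 / 2) : ℝ) *
    Real.exp (-(1 / 2) * ((x - μ).ofLp ⬝ᵥ (S⁻¹ *ᵥ (x - μ).ofLp)))

theorem stdGaussian_eq_withDensity (n : ℕ) :
    stdGaussian (EuclideanSpace ℝ (Fin n)) = volume.withDensity fun x =>
      ENNReal.ofReal ((√(2 * Real.pi))⁻¹ ^ n * Real.exp (-(1 / 2) * (x.ofLp ⬝ᵥ x.ofLp))) := by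
  rw [← map_pi_eq_stdGaussian, gaussianReal_of_var_ne_zero 0 one_ne_zero]
  have : SigmaFinite ((volume : Measure ℝ).withDensity (gaussianPDF 0 1)) := by
    rw [← gaussianReal_of_var_ne_zero 0 one_ne_zero]; infer_instance
  rw [pi_withDensity_fin _ _ (fun _ => measurable_gaussianPDF 0 1),
    ← (PiLp.volume_preserving_toLp (Fin n)).map_eq,
    ← Measure.map_withDensity_comp _ (by fun_prop) (by fun_prop)]
  congr 2
  ext x
  simp only [gaussianPDF, gaussianPDFReal]
  rw [← ENNReal.ofReal_prod_of_nonneg (fun i _ => by positivity)]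
  simp [Finset.prod_mul_distrib, ← Real.exp_sum, dotProduct, Finset.mul_sum]
  rw [← Finset.sum_neg_distrib]
  congr 3
  exact Finset.sum_congr rfl fun i _ => by ring

theorem det_toEuclideanCLM {n : ℕ} (A : Matrix (Fin n) (Fin n) ℝ) :
    LinearMap.det (Matrix.toEuclideanCLM (𝕜 := ℝ) A : EuclideanSpace ℝ (Fin n) →ₗ[ℝ] _) =
      A.det := by
  change LinearMap.det (Matrix.toLpLin 2 2 A) = A.det
  rw [Matrix.toLpLin_eq_toLin, LinearMap.det_toLin]

open scoped MatrixOrder in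
/-- The density follows from that of the standard Gaussian by the change of variables
`x ↦ μ + √S x`, whose Jacobian is `√(det S)`. -/
theorem multivariateGaussian_eq_withDensity {n : ℕ} (μ : EuclideanSpace ℝ (Fin n))
    {S : Matrix (Fin n) (Fin n) ℝ} (hS : S.PosDef) :
    multivariateGaussian μ S = volume.withDensity fun x =>
      ENNReal.ofReal (multivariateGaussianDensity μ S x) := by
  set A := CFC.sqrt S with hA
  have hAA : A * A = S := CFC.sqrt_mul_sqrt_self _ hS.posSemidef.nonneg
  have hAT : Aᵀ = A := by
    have := (CFC.sqrt_nonneg S).isSelfAdjoint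
    simpa [IsSelfAdjoint, Matrix.star_eq_conjTranspose] using this
  have hdet : A.det * A.det = S.det := by rw [← Matrix.det_mul, hAA]
  have hdet0 : A.det ≠ 0 := fun h => hS.det_pos.ne' (by rw [← hdet, h, zero_mul])
  have hASA : A * S⁻¹ * A = 1 := by
    rw [← hAA, Matrix.mul_inv_rev, ← mul_assoc, Matrix.mul_nonsing_inv _ (Ne.isUnit hdet0), one_mul,
      Matrix.nonsing_inv_mul _ (Ne.isUnit hdet0)]
  have habs : |A.det⁻¹| = S.det ^ (-(1 / 2) : ℝ) := by
    rw [Real.rpow_neg hS.det_pos.le, ← Real.sqrt_eq_rpow, ← hdet,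
      Real.sqrt_mul_self_eq_abs, abs_inv]
  let c : ℝ := (√(2 * Real.pi))⁻¹ ^ n
  let h : EuclideanSpace ℝ (Fin n) → ℝ≥0∞ := fun x =>
    ENNReal.ofReal (c * Real.exp (-(1 / 2) * ((x - μ).ofLp ⬝ᵥ (S⁻¹ *ᵥ (x - μ).ofLp))))
  have hh : Measurable h := by
    have : Continuous fun x : EuclideanSpace ℝ (Fin n) => S⁻¹ *ᵥ (x - μ).ofLp :=
      Continuous.matrix_mulVec continuous_const (by fun_prop)
    have h2 : Continuous fun x : EuclideanSpace ℝ (Fin n) =>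
      (x - μ).ofLp ⬝ᵥ (S⁻¹ *ᵥ (x - μ).ofLp) := Continuous.dotProduct (by fun_prop) this
    exact ((h2.const_mul _).rexp.const_mul _).measurable.ennreal_ofReal
  have hmap : (volume : Measure (EuclideanSpace ℝ (Fin n))).map
      (fun x => μ + Matrix.toEuclideanCLM (𝕜 := ℝ) A x) =
      ENNReal.ofReal (S.det ^ (-(1 / 2) : ℝ)) • volume := by
    have := Measure.map_linearMap_addHaar_eq_smul_addHaar
      (volume : Measure (EuclideanSpace ℝ (Fin n)))
      (f := (Matrix.toEuclideanCLM (𝕜 := ℝ) A : EuclideanSpace ℝ (Fin n) →ₗ[ℝ] _))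
      (by rwa [det_toEuclideanCLM])
    rw [det_toEuclideanCLM, habs] at this
    change Measure.map ((fun x => μ + x) ∘ _) _ = _
    rw [← Measure.map_map (by fun_prop) (by fun_prop)]
    erw [this]
    rw [Measure.map_smul, map_add_left_eq_self]
  have hstd : stdGaussian (EuclideanSpace ℝ (Fin n)) = volume.withDensity
      fun x => h (μ + Matrix.toEuclideanCLM (𝕜 := ℝ) A x) := by
    rw [stdGaussian_eq_withDensity]
    congr 1
    ext x
    simp only [h, c, add_sub_cancel_left]
    congr 4
    rw [Matrix.ofLp_toEuclideanCLM, Matrix.mulVec_mulVec, ← hAT, Matrix.mulVec_transpose, hAT,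
      ← Matrix.dotProduct_mulVec, Matrix.mulVec_mulVec, ← mul_assoc, hASA, Matrix.one_mulVec]
  rw [multivariateGaussian, hstd, Measure.map_withDensity_comp _ (by fun_prop) hh, ← hA, hmap,
    withDensity_smul_measure, ← withDensity_smul _ hh]
  congr 1
  ext x
  simp only [h, c, Pi.smul_apply, smul_eq_mul, multivariateGaussianDensity]
  rw [← ENNReal.ofReal_mul (Real.rpow_nonneg hS.det_pos.le _)]
  congr 1
  ring

/-! ### Lebesgue measure on symmetric matrices and the Inverse Wishart kernel -/

instance {n : ℕ} : BorelSpace (Matrix (Fin n) (Fin n) ℝ) :=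
  inferInstanceAs (BorelSpace (Fin n → Fin n → ℝ))

instance {n : ℕ} : SFinite (symmetricLebesgue n) := by
  unfold symmetricLebesgue; infer_instance

theorem measurable_matrix_entry {n : ℕ} (i j : Fin n) :
    Measurable fun S : Matrix (Fin n) (Fin n) ℝ => S i j :=
  (measurable_pi_apply j).comp (measurable_pi_apply (X := fun _ : Fin n => Fin n → ℝ) i)

theorem continuous_symmetricOfUpper {n : ℕ} : Continuous (symmetricOfUpper (n := n)) :=
  continuous_matrix fun _ _ => continuous_apply _

theorem measurableSet_posDef (n : ℕ) :
    MeasurableSet {S : Matrix (Fin n) (Fin n) ℝ | S.PosDef} := by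
  -- A matrix is positive definite iff it is positive semidefinite, which is a closed condition,
  -- and has nonzero determinant, which is an open one.
  have : {S : Matrix (Fin n) (Fin n) ℝ | S.PosDef} =
      ({S | Sᴴ = S} ∩ ⋂ x : Fin n → ℝ, {S | 0 ≤ star x ⬝ᵥ (S *ᵥ x)}) ∩ {S | S.det = 0}ᶜ := by
    ext S
    simp only [Set.mem_ofPred_eq, Set.mem_inter_iff, Set.mem_iInter, Set.mem_compl_iff]
    constructor
    · exact fun h => ⟨⟨h.1, h.posSemidef.dotProduct_mulVec_nonneg⟩, h.det_pos.ne'⟩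
    · rintro ⟨⟨h1, h2⟩, h3⟩
      exact (Matrix.PosSemidef.of_dotProduct_mulVec_nonneg h1 h2).posDef_iff_det_ne_zero.2 h3
  rw [this]
  refine (IsClosed.inter ?_ (isClosed_iInter fun x => ?_)).measurableSet.inter
    (IsClosed.measurableSet ?_).compl
  · exact isClosed_eq (by fun_prop) continuous_id
  · exact isClosed_le continuous_const
      (continuous_const.dotProduct (continuous_id.matrix_mulVec continuous_const))
  · exact isClosed_eq continuous_id.matrix_det continuous_const

/-- A symmetric matrix close enough to the identity is positive definite. -/
theorem posDef_of_abs_sub_one_lt {n : ℕ} {S : Matrix (Fin n) (Fin n) ℝ} (hS : S.IsHermitian)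
    (h : ∀ i j, |S i j - (1 : Matrix (Fin n) (Fin n) ℝ) i j| < 1 / (n + 1)) : S.PosDef := by
  refine Matrix.PosDef.of_dotProduct_mulVec_pos hS fun x hx => ?_
  have hpos : 0 < x ⬝ᵥ x := by
    simpa using Matrix.dotProduct_star_self_pos_iff.2 hx
  have hE : |x ⬝ᵥ ((S - 1) *ᵥ x)| ≤ (∑ i, |x i|) ^ 2 * (1 / (n + 1)) := by
    rw [sq, Finset.sum_mul_sum, Finset.sum_mul]
    refine (Finset.abs_sum_le_sum_abs _ _).trans (Finset.sum_le_sum fun i _ => ?_)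
    rw [Matrix.mulVec, dotProduct, Finset.mul_sum, Finset.sum_mul]
    refine (Finset.abs_sum_le_sum_abs _ _).trans (Finset.sum_le_sum fun j _ => ?_)
    have := (h i j).le
    rw [abs_mul, abs_mul, Matrix.sub_apply]
    calc |x i| * (|S i j - (1 : Matrix (Fin n) (Fin n) ℝ) i j| * |x j|)
        ≤ |x i| * (1 / (n + 1) * |x j|) := by gcongr
      _ = _ := by ring
  have hsq : (∑ i, |x i|) ^ 2 ≤ n * (x ⬝ᵥ x) := by
    have := sq_sum_le_card_mul_sum_sq (s := Finset.univ) (f := fun i => |x i|)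
    simpa [dotProduct, sq] using this
  have hdec : star x ⬝ᵥ (S *ᵥ x) = x ⬝ᵥ x + x ⬝ᵥ ((S - 1) *ᵥ x) := by
    rw [Matrix.sub_mulVec, Matrix.one_mulVec, dotProduct_sub]; simp
  rw [hdec]
  have h1 : (∑ i, |x i|) ^ 2 * (1 / (n + 1)) ≤ n * (x ⬝ᵥ x) * (1 / (n + 1)) := by gcongr
  have h2 : (n : ℝ) * (x ⬝ᵥ x) * (1 / (n + 1)) < x ⬝ᵥ x := by
    rw [mul_one_div, div_lt_iff₀ (by positivity)]
    linarith
  linarith [neg_abs_le (x ⬝ᵥ ((S - 1) *ᵥ x))]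

theorem symmetricOfUpper_isHermitian {n : ℕ} (v : {p : Fin n × Fin n // p.1 ≤ p.2} → ℝ) :
    (symmetricOfUpper v).IsHermitian := by
  ext i j
  simp [symmetricOfUpper, min_comm, max_comm]

theorem symmetricLebesgue_posDef_ne_zero (n : ℕ) :
    symmetricLebesgue n {S | S.PosDef} ≠ 0 := by
  rw [symmetricLebesgue, Measure.map_apply continuous_symmetricOfUpper.measurable
    (measurableSet_posDef n)]
  -- The positive definite matrices contain a neighbourhood of the identity.
  let U : Set ({p : Fin n × Fin n // p.1 ≤ p.2} → ℝ) :=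
    ⋂ i, ⋂ j, {v | |symmetricOfUpper v i j - (1 : Matrix (Fin n) (Fin n) ℝ) i j| < 1 / (n + 1)}
  have hU : IsOpen U := isOpen_iInter_of_finite fun i => isOpen_iInter_of_finite fun j =>
    isOpen_lt (((continuous_symmetricOfUpper.matrix_elem i j).sub continuous_const).abs)
      continuous_const
  have hne : U.Nonempty := by
    refine ⟨fun p => (1 : Matrix (Fin n) (Fin n) ℝ) p.1.1 p.1.2, ?_⟩
    simp only [U, Set.mem_iInter, Set.mem_ofPred_eq]
    intro i j
    have : symmetricOfUpper (fun p => (1 : Matrix (Fin n) (Fin n) ℝ) p.1.1 p.1.2) i j =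
        (1 : Matrix (Fin n) (Fin n) ℝ) i j := by
      change (1 : Matrix (Fin n) (Fin n) ℝ) (min i j) (max i j) = _
      rcases le_total i j with h | h
      · rw [min_eq_left h, max_eq_right h]
      · rw [min_eq_right h, max_eq_left h, Matrix.one_apply, Matrix.one_apply]
        simp only [eq_comm]
    rw [this]
    simp only [sub_self, abs_zero]
    positivity
  refine ((hU.measure_pos volume hne).trans_le (measure_mono fun v hv => ?_)).ne'
  simp only [U, Set.mem_iInter, Set.mem_ofPred_eq] at hv
  exact posDef_of_abs_sub_one_lt (symmetricOfUpper_isHermitian v) hv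

theorem inverseWishartKernel_pos {n : ℕ} (ν : ℝ) (Ψ : Matrix (Fin n) (Fin n) ℝ)
    {S : Matrix (Fin n) (Fin n) ℝ} (hS : S.PosDef) : 0 < inverseWishartKernel ν Ψ S :=
  mul_pos (Real.rpow_pos_of_pos hS.det_pos _) (Real.exp_pos _)

theorem measurable_matrix_inv_entry {n : ℕ} (i j : Fin n) :
    Measurable fun S : Matrix (Fin n) (Fin n) ℝ => S⁻¹ i j := by
  simp only [Matrix.inv_def, Ring.inverse_eq_inv', Matrix.smul_apply, smul_eq_mul]
  exact continuous_id.matrix_det.measurable.inv.mul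
    (continuous_id.matrix_adjugate.matrix_elem i j).measurable

theorem measurable_inverseWishartKernel_uncurry {n : ℕ} (ν : ℝ) :
    Measurable fun p : Matrix (Fin n) (Fin n) ℝ × Matrix (Fin n) (Fin n) ℝ =>
      inverseWishartKernel ν p.1 p.2 := by
  unfold inverseWishartKernel
  refine ((continuous_id.matrix_det.measurable.comp measurable_snd).pow_const _).mul
    (Measurable.exp (Measurable.const_mul ?_ _))
  simp only [Matrix.trace, Matrix.diag, Matrix.mul_apply]
  exact Finset.measurable_sum _ fun i _ => Finset.measurable_sum _ fun j _ =>
    ((measurable_matrix_entry i j).comp measurable_fst).mul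
      ((measurable_matrix_inv_entry j i).comp measurable_snd)

theorem measurable_inverseWishartKernel {n : ℕ} (ν : ℝ) (Ψ : Matrix (Fin n) (Fin n) ℝ) :
    Measurable (inverseWishartKernel ν Ψ) :=
  (measurable_inverseWishartKernel_uncurry ν).comp measurable_prodMk_left

theorem inverseWishartUnnormalized_univ {n : ℕ} (ν : ℝ) (Ψ : Matrix (Fin n) (Fin n) ℝ) :
    inverseWishartUnnormalized ν Ψ Set.univ =
      ∫⁻ S in {S | S.PosDef}, ENNReal.ofReal (inverseWishartKernel ν Ψ S)
        ∂symmetricLebesgue n := by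
  rw [inverseWishartUnnormalized, withDensity_apply _ MeasurableSet.univ, Measure.restrict_univ]

theorem inverseWishartUnnormalized_univ_ne_zero {n : ℕ} (ν : ℝ) (Ψ : Matrix (Fin n) (Fin n) ℝ) :
    inverseWishartUnnormalized ν Ψ Set.univ ≠ 0 := by
  rw [inverseWishartUnnormalized_univ]
  refine ((setLIntegral_pos_iff
    (measurable_inverseWishartKernel ν Ψ).ennreal_ofReal).2 ?_).ne'
  refine (pos_iff_ne_zero.2 (symmetricLebesgue_posDef_ne_zero n)).trans_le
    (measure_mono fun S hS => ⟨?_, hS⟩)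
  simpa using inverseWishartKernel_pos ν Ψ hS

/-! ### Bordered matrices -/

/-- The symmetric block matrix `[[c, bᵀ], [b, A]]`. -/
def borderedMatrix {n : ℕ} (A : Matrix (Fin n) (Fin n) ℝ) (b : Fin n → ℝ) (c : ℝ) :
    Matrix (Fin (n + 1)) (Fin (n + 1)) ℝ :=
  Matrix.of (Fin.cons (Fin.cons c b) fun i => Fin.cons (b i) (A i))

section borderedMatrix

variable {n : ℕ} (A : Matrix (Fin n) (Fin n) ℝ) (b : Fin n → ℝ) (c : ℝ)

@[simp] theorem borderedMatrix_zero_zero : borderedMatrix A b c 0 0 = c := rfl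

@[simp] theorem borderedMatrix_zero_succ (j : Fin n) : borderedMatrix A b c 0 j.succ = b j := rfl

@[simp] theorem borderedMatrix_succ_zero (i : Fin n) : borderedMatrix A b c i.succ 0 = b i := rfl

@[simp] theorem borderedMatrix_succ_succ (i j : Fin n) :
    borderedMatrix A b c i.succ j.succ = A i j := rfl

theorem measurable_borderedMatrix :
    Measurable fun p : Matrix (Fin n) (Fin n) ℝ × ℝ × (Fin n → ℝ) =>
      borderedMatrix p.1 p.2.2 p.2.1 := by
  refine measurable_pi_lambda _ fun i => measurable_pi_lambda _ fun j => ?_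
  refine Fin.cases ?_ (fun i => ?_) i <;> refine Fin.cases ?_ (fun j => ?_) j
  · exact measurable_snd.fst
  · exact (measurable_pi_apply j).comp measurable_snd.snd
  · exact (measurable_pi_apply i).comp measurable_snd.snd
  · exact (measurable_matrix_entry i j).comp measurable_fst

variable {A b c}

theorem posDef_of_borderedMatrix (h : (borderedMatrix A b c).PosDef) : A.PosDef :=
  h.submatrix (Fin.succ_injective n)

theorem det_borderedMatrix (hA : A.det ≠ 0) :
    (borderedMatrix A b c).det = A.det * (c - b ⬝ᵥ (A⁻¹ *ᵥ b)) := by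
  let e : Fin n ⊕ Unit ≃ Fin (n + 1) :=
    (Equiv.optionEquivSumPUnit (Fin n)).symm.trans (finSuccEquiv n).symm
  have hS : (borderedMatrix A b c).submatrix e e = Matrix.fromBlocks A
      (Matrix.replicateCol Unit b) (Matrix.replicateRow Unit b) (Matrix.of fun _ _ => c) := by
    ext i j
    rcases i with i | i <;> rcases j with j | j <;> simp [e]
  let _ : Invertible A := Matrix.invertibleOfIsUnitDet _ (Ne.isUnit hA)
  rw [← Matrix.det_submatrix_equiv_self e, hS, Matrix.det_fromBlocks₁₁, Matrix.invOf_eq_nonsing_inv,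
    Matrix.mul_assoc, Matrix.det_unique (n := Unit)]
  rfl

theorem trace_borderedMatrix : (borderedMatrix A b c).trace = c + A.trace := by
  simp [Matrix.trace, Fin.sum_univ_succ]

/-- The inverse of a bordered matrix is again bordered; `d` is the Schur complement of `A`. -/
theorem inv_borderedMatrix (hA : A.det ≠ 0) (hAT : Aᵀ = A) {d : ℝ} (hd : d ≠ 0)
    (hc : c = d + b ⬝ᵥ (A⁻¹ *ᵥ b)) :
    (borderedMatrix A b c)⁻¹ =
      borderedMatrix (A⁻¹ + d⁻¹ • Matrix.vecMulVec (A⁻¹ *ᵥ b) (A⁻¹ *ᵥ b))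
        (-d⁻¹ • (A⁻¹ *ᵥ b)) d⁻¹ := by
  have hA' : IsUnit A.det := Ne.isUnit hA
  set u := A⁻¹ *ᵥ b with hu
  have hAu : A *ᵥ u = b := by rw [hu, Matrix.mulVec_mulVec, Matrix.mul_nonsing_inv _ hA',
    Matrix.one_mulVec]
  have hAu' (i : Fin n) : ∑ k, A i k * u k = b i := congrFun hAu i
  have hbA (j : Fin n) : ∑ k, b k * A⁻¹ k j = u j := by
    have : A⁻¹ᵀ = A⁻¹ := by rw [Matrix.transpose_nonsing_inv, hAT]
    rw [hu, ← this, Matrix.mulVec_transpose, this]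
    rfl
  have hAA (i j : Fin n) : ∑ k, A i k * A⁻¹ k j = (1 : Matrix (Fin n) (Fin n) ℝ) i j := by
    rw [← Matrix.mul_nonsing_inv _ hA']; rfl
  have hbu : ∑ k, b k * u k = c - d := by rw [hc]; simp [dotProduct]
  refine Matrix.inv_eq_right_inv ?_
  ext i j
  rw [Matrix.mul_apply, Fin.sum_univ_succ]
  refine Fin.cases ?_ (fun i => ?_) i <;> refine Fin.cases ?_ (fun j => ?_) j
  · have : ∑ k, b k * (-d⁻¹ * u k) = -d⁻¹ * ∑ k, b k * u k := by
      rw [Finset.mul_sum]; exact Finset.sum_congr rfl fun k _ => by ring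
    simp only [borderedMatrix_zero_zero, borderedMatrix_zero_succ, borderedMatrix_succ_zero,
      Pi.smul_apply, smul_eq_mul, this, hbu, Matrix.one_apply_eq]
    field_simp
    ring
  · have : ∑ k, b k * (A⁻¹ k j + d⁻¹ * (u k * u j)) =
        ∑ k, b k * A⁻¹ k j + d⁻¹ * u j * ∑ k, b k * u k := by
      rw [Finset.mul_sum, ← Finset.sum_add_distrib]
      exact Finset.sum_congr rfl fun k _ => by ring
    simp only [borderedMatrix_zero_zero, borderedMatrix_zero_succ, borderedMatrix_succ_succ,
      Pi.smul_apply, smul_eq_mul, Matrix.add_apply, Matrix.smul_apply, Matrix.vecMulVec_apply, this,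
      hbu, hbA, Matrix.one_apply_ne (Fin.succ_ne_zero j).symm]
    field_simp
    ring
  · have : ∑ k, A i k * (-d⁻¹ * u k) = -d⁻¹ * ∑ k, A i k * u k := by
      rw [Finset.mul_sum]; exact Finset.sum_congr rfl fun k _ => by ring
    simp only [borderedMatrix_zero_zero, borderedMatrix_succ_succ, borderedMatrix_succ_zero,
      Pi.smul_apply, smul_eq_mul, this, hAu', Matrix.one_apply_ne (Fin.succ_ne_zero i)]
    ring
  · have : ∑ k, A i k * (A⁻¹ k j + d⁻¹ * (u k * u j)) =
        ∑ k, A i k * A⁻¹ k j + d⁻¹ * u j * ∑ k, A i k * u k := by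
      rw [Finset.mul_sum, ← Finset.sum_add_distrib]
      exact Finset.sum_congr rfl fun k _ => by ring
    have h1 : (1 : Matrix (Fin (n + 1)) (Fin (n + 1)) ℝ) i.succ j.succ =
      (1 : Matrix (Fin n) (Fin n) ℝ) i j := by simp [Matrix.one_apply]
    simp only [borderedMatrix_zero_succ, borderedMatrix_succ_succ, borderedMatrix_succ_zero,
      Pi.smul_apply, smul_eq_mul, Matrix.add_apply, Matrix.smul_apply, Matrix.vecMulVec_apply, this,
      hAu', hAA, h1]
    ring

end borderedMatrix

/-! ### Lebesgue measure on bordered symmetric matrices -/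

/-- The upper triangular index pairs of an `(n + 1) × (n + 1)` matrix are those of the lower right
`n × n` block together with the first row. -/
noncomputable def upperSuccEquiv (n : ℕ) :
    {p : Fin n × Fin n // p.1 ≤ p.2} ⊕ Fin (n + 1) ≃
      {p : Fin (n + 1) × Fin (n + 1) // p.1 ≤ p.2} :=
  Equiv.ofBijective
    (Sum.elim (fun p => ⟨(p.1.1.succ, p.1.2.succ), Fin.succ_le_succ_iff.2 p.2⟩)
      fun j => ⟨(0, j), Fin.zero_le j⟩) <| by
    constructor
    · rintro (⟨⟨i, j⟩, h⟩ | i) (⟨⟨i', j'⟩, h'⟩ | i') heq <;>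
        simp_all [Fin.ext_iff]
    · rintro ⟨⟨i, j⟩, h⟩
      induction i using Fin.cases with
      | zero => exact ⟨Sum.inr j, rfl⟩
      | succ i =>
        induction j using Fin.cases with
        | zero => simp at h
        | succ j => exact ⟨Sum.inl ⟨(i, j), Fin.succ_le_succ_iff.1 h⟩, rfl⟩

/-- Lebesgue measure on symmetric `(n + 1) × (n + 1)` matrices is the product of the Lebesgue
measures on the lower right block, the corner and the rest of the border. -/
theorem symmetricLebesgue_succ (n : ℕ) :
    symmetricLebesgue (n + 1) =
      ((symmetricLebesgue n).prod (volume : Measure (ℝ × (Fin n → ℝ)))).map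
        fun p => borderedMatrix p.1 p.2.2 p.2.1 := by
  let F := (MeasurableEquiv.sumPiEquivProdPi
      fun _ : {p : Fin n × Fin n // p.1 ≤ p.2} ⊕ Fin (n + 1) => ℝ).symm.trans
    (MeasurableEquiv.piCongrLeft (fun _ => ℝ) (upperSuccEquiv n))
  have hF : MeasurePreserving F volume volume :=
    (volume_measurePreserving_sumPiEquivProdPi fun _ => ℝ).symm.trans
      (volume_measurePreserving_piCongrLeft (fun _ => ℝ) (upperSuccEquiv n))
  have hC := (volume_preserving_piFinSuccAbove (fun _ : Fin (n + 1) => ℝ) 0).symm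
  have hG := (MeasurePreserving.id
    (volume : Measure ({p : Fin n × Fin n // p.1 ≤ p.2} → ℝ))).prod hC
  have hFG := hF.comp hG
  have hmeas := measurable_borderedMatrix (n := n)
  rw [symmetricLebesgue, symmetricLebesgue, ← hFG.map_eq,
    Measure.map_map continuous_symmetricOfUpper.measurable hFG.measurable]
  conv_rhs => rw [← Measure.map_id (μ := (volume : Measure (ℝ × (Fin n → ℝ)))),
    Measure.map_prod_map _ _ continuous_symmetricOfUpper.measurable measurable_id,
    Measure.map_map hmeas (continuous_symmetricOfUpper.measurable.prodMap measurable_id)]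
  congr 1
  ext ⟨v, c, b⟩ i j
  have hl (p : {p : Fin n × Fin n // p.1 ≤ p.2}) (w : Fin (n + 1) → ℝ) :
      F (v, w) ⟨(p.1.1.succ, p.1.2.succ), Fin.succ_le_succ_iff.2 p.2⟩ = v p :=
    Equiv.piCongrLeft_sumInl (fun _ => ℝ) (upperSuccEquiv n) v w p
  have hr (k : Fin (n + 1)) (w : Fin (n + 1) → ℝ) : F (v, w) ⟨(0, k), Fin.zero_le k⟩ = w k :=
    Equiv.piCongrLeft_sumInr (fun _ => ℝ) (upperSuccEquiv n) v w k
  have hw : (MeasurableEquiv.piFinSuccAbove (fun _ : Fin (n + 1) => ℝ) 0).symm (c, b) =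
      Fin.cons c b := by
    simp [MeasurableEquiv.piFinSuccAbove, Fin.insertNthEquiv]
  simp only [Function.comp_apply, Prod.map_apply, id_eq, hw]
  change F (v, Fin.cons c b) ⟨(min i j, max i j), min_le_max⟩ = _
  induction i using Fin.cases with
  | zero =>
    have : (⟨(min 0 j, max 0 j), min_le_max⟩ : {p : Fin (n + 1) × Fin (n + 1) // p.1 ≤ p.2}) =
      ⟨(0, j), Fin.zero_le j⟩ := by simp
    rw [this, hr]
    induction j using Fin.cases <;> rfl
  | succ i =>
    induction j using Fin.cases with
    | zero =>
      have : (⟨(min i.succ 0, max i.succ 0), min_le_max⟩ :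
          {p : Fin (n + 1) × Fin (n + 1) // p.1 ≤ p.2}) = ⟨(0, i.succ), Fin.zero_le _⟩ := by simp
      rw [this, hr]; rfl
    | succ j =>
      have : (⟨(min i.succ j.succ, max i.succ j.succ), min_le_max⟩ :
          {p : Fin (n + 1) × Fin (n + 1) // p.1 ≤ p.2}) =
          ⟨((min i j).succ, (max i j).succ), Fin.succ_le_succ_iff.2 min_le_max⟩ := by
        simp only [Fin.strictMono_succ.monotone.map_min, Fin.strictMono_succ.monotone.map_max]
      rw [this, hl ⟨(min i j, max i j), min_le_max⟩]
      rfl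

/-! ### The Inverse Wishart distribution is a probability measure -/

theorem lintegral_exp_neg_mul_dotProduct_lt_top (n : ℕ) {a : ℝ} (ha : 0 < a) :
    ∫⁻ v : Fin n → ℝ, ENNReal.ofReal (Real.exp (-a * (v ⬝ᵥ v))) < ∞ := by
  have : ∀ v : Fin n → ℝ, ENNReal.ofReal (Real.exp (-a * (v ⬝ᵥ v))) =
      ∏ i, ENNReal.ofReal (Real.exp (-a * v i ^ 2)) := fun v => by
    rw [← ENNReal.ofReal_prod_of_nonneg (fun i _ => by positivity), ← Real.exp_sum, dotProduct,
      Finset.mul_sum]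
    simp only [sq]
  simp_rw [this]
  rw [volume_pi, lintegral_pi_fin_prod (fun _ : Fin n => (volume : Measure ℝ))
    (fun _ x => ENNReal.ofReal (Real.exp (-a * x ^ 2))) fun _ => by fun_prop]
  exact ENNReal.prod_lt_top fun i _ => (integrable_exp_neg_mul_sq ha).lintegral_lt_top

theorem lintegral_comp_mulVec {n : ℕ} {M : Matrix (Fin n) (Fin n) ℝ} (hM : M.det ≠ 0)
    {f : (Fin n → ℝ) → ℝ≥0∞} (hf : Measurable f) :
    ∫⁻ b, f (M *ᵥ b) = ENNReal.ofReal |M.det⁻¹| * ∫⁻ v, f v := by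
  have := Real.map_matrix_volume_pi_eq_smul_volume_pi hM
  rw [← smul_eq_mul, ← lintegral_smul_measure, ← this,
    lintegral_map hf (Matrix.toLin' M).continuous_of_finiteDimensional.measurable]
  rfl

/-- The Gaussian integral over `b ∈ ℝⁿ` that is responsible for the shift of the exponent of
`det A` when the border of a matrix is integrated out. -/
theorem lintegral_exp_neg_inv_mulVec {n : ℕ} {A : Matrix (Fin n) (Fin n) ℝ} (hA : 0 < A.det)
    {d : ℝ} (hd : 0 < d) (a : ℝ) :
    ∫⁻ b : Fin n → ℝ, ENNReal.ofReal (Real.exp (-a * ((A⁻¹ *ᵥ b) ⬝ᵥ (A⁻¹ *ᵥ b) / d))) =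
      ENNReal.ofReal (A.det * d ^ ((n : ℝ) / 2)) *
        ∫⁻ v : Fin n → ℝ, ENNReal.ofReal (Real.exp (-a * (v ⬝ᵥ v))) := by
  have hdet : ((√d)⁻¹ • A⁻¹).det = (A.det * d ^ ((n : ℝ) / 2))⁻¹ := by
    rw [Matrix.det_smul, Matrix.det_nonsing_inv, Ring.inverse_eq_inv', Fintype.card_fin, mul_inv,
      inv_pow, Real.sqrt_eq_rpow, ← Real.rpow_mul_natCast hd.le, mul_comm]
    congr 3
    ring
  have hpos : 0 < A.det * d ^ ((n : ℝ) / 2) := by positivity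
  have := lintegral_comp_mulVec (M := (√d)⁻¹ • A⁻¹) (by rw [hdet]; positivity)
    (f := fun v => ENNReal.ofReal (Real.exp (-a * (v ⬝ᵥ v)))) (by
      have : Continuous fun v : Fin n → ℝ => v ⬝ᵥ v := continuous_id.dotProduct continuous_id
      exact (this.const_mul _).rexp.measurable.ennreal_ofReal)
  rw [hdet, inv_inv, abs_of_pos hpos] at this
  rw [← this]
  refine lintegral_congr fun b => ?_
  congr 3
  rw [Matrix.smul_mulVec, smul_dotProduct, dotProduct_smul, smul_smul, ← mul_inv,
    Real.mul_self_sqrt hd.le, smul_eq_mul]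
  ring

/-- Up to a constant factor, the inverse gamma density is integrable on `(0, ∞)`. -/
theorem lintegral_inverse_gamma_lt_top {s a : ℝ} (hs : 0 < s) (ha : 0 < a) :
    ∫⁻ d in Set.Ioi (0 : ℝ), ENNReal.ofReal (d ^ (-s - 1) * Real.exp (-a * d⁻¹)) < ∞ := by
  have h1 : IntegrableOn (fun u : ℝ => u ^ (s - 1) * Real.exp (-a * u ^ (1 : ℝ))) (Set.Ioi 0) :=
    integrableOn_rpow_mul_exp_neg_mul_rpow (by linarith) one_pos ha
  have h2 := (integrableOn_Ioi_comp_rpow_iff _ (p := -1) (by norm_num)).2 h1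
  have h3 : IntegrableOn (fun d : ℝ => d ^ (-s - 1) * Real.exp (-a * d⁻¹)) (Set.Ioi 0) := by
    refine h2.congr_fun (fun d hd => ?_) measurableSet_Ioi
    have hd : 0 < d := hd
    simp only [Real.rpow_one, smul_eq_mul, abs_neg, abs_one, one_mul]
    rw [← mul_assoc, ← Real.rpow_mul hd.le, ← Real.rpow_add hd, Real.rpow_neg_one]
    congr 2
    ring
  exact h3.lintegral_lt_top

/-- The value of the Inverse Wishart kernel with scalar scale matrix at a bordered matrix, in terms
of the corner `A`, the border `b` and the Schur complement `d`. -/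
theorem inverseWishartKernel_borderedMatrix {n : ℕ} {A : Matrix (Fin n) (Fin n) ℝ}
    (hA : A.PosDef) (b : Fin n → ℝ) {d : ℝ} (hd : 0 < d) (ν a : ℝ) :
    inverseWishartKernel ν ((2 * a) • (1 : Matrix (Fin (n + 1)) (Fin (n + 1)) ℝ))
        (borderedMatrix A b (d + b ⬝ᵥ (A⁻¹ *ᵥ b))) =
      A.det ^ (-(ν + n + 2) / 2) * Real.exp (-a * A⁻¹.trace) *
        (d ^ (-(ν + n + 2) / 2) * Real.exp (-a * d⁻¹)) *
          Real.exp (-a * ((A⁻¹ *ᵥ b) ⬝ᵥ (A⁻¹ *ᵥ b) / d)) := by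
  have hAT : Aᵀ = A := by simpa using hA.1.eq
  rw [inverseWishartKernel, det_borderedMatrix hA.det_pos.ne', add_sub_cancel_right,
    inv_borderedMatrix hA.det_pos.ne' hAT hd.ne' rfl, smul_mul_assoc, one_mul, Matrix.trace_smul,
    trace_borderedMatrix, Matrix.trace_add, Matrix.trace_smul, Matrix.trace_vecMulVec,
    Real.mul_rpow hA.det_pos.le hd.le]
  have hν : -(ν + ((n + 1 : ℕ) : ℝ) + 1) / 2 = -(ν + n + 2) / 2 := by push_cast; ring
  have hexp : -(1 / 2) * (2 * a) • (d⁻¹ + (A⁻¹.trace + d⁻¹ • ((A⁻¹ *ᵥ b) ⬝ᵥ (A⁻¹ *ᵥ b)))) =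
      -a * A⁻¹.trace + -a * d⁻¹ + -a * ((A⁻¹ *ᵥ b) ⬝ᵥ (A⁻¹ *ᵥ b) / d) := by
    simp only [smul_eq_mul]; ring
  rw [hν, hexp, Real.exp_add, Real.exp_add]
  ring

/-- Integration over symmetric `(n + 1) × (n + 1)` matrices in the coordinates given by the block
`A`, the border `b` and the Schur complement `d = c - bᵀ A⁻¹ b` instead of the corner `c`. For
fixed `A` and `b` this is a translation in `c`, so there is no Jacobian. -/
theorem lintegral_symmetricLebesgue_succ {n : ℕ}
    {f : Matrix (Fin (n + 1)) (Fin (n + 1)) ℝ → ℝ≥0∞} (hf : Measurable f) :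
    ∫⁻ S, f S ∂symmetricLebesgue (n + 1) =
      ∫⁻ A, (∫⁻ d : ℝ, ∫⁻ b : Fin n → ℝ, f (borderedMatrix A b (d + b ⬝ᵥ (A⁻¹ *ᵥ b))))
        ∂symmetricLebesgue n := by
  have hmeas := measurable_borderedMatrix (n := n)
  rw [symmetricLebesgue_succ, lintegral_map hf hmeas]
  refine (lintegral_prod _ (hf.comp hmeas).aemeasurable).trans ?_
  refine lintegral_congr fun A => ?_
  have hfA : Measurable fun p : ℝ × (Fin n → ℝ) => f (borderedMatrix A p.2 p.1) :=
    (hf.comp hmeas).comp measurable_prodMk_left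
  have hq : Measurable fun b : Fin n → ℝ => b ⬝ᵥ (A⁻¹ *ᵥ b) :=
    (continuous_id.dotProduct (continuous_const.matrix_mulVec continuous_id)).measurable
  rw [Measure.volume_eq_prod]
  refine (lintegral_prod _ hfA.aemeasurable).trans ?_
  rw [lintegral_lintegral_swap (f := fun x y => f (borderedMatrix A y x)) hfA.aemeasurable]
  rw [lintegral_lintegral_swap (f := fun d b => f (borderedMatrix A b (d + b ⬝ᵥ (A⁻¹ *ᵥ b))))]
  · exact lintegral_congr fun b =>
      (lintegral_add_right_eq_self (fun c => f (borderedMatrix A b c)) _).symm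
  · exact (hfA.comp ((measurable_fst.add (hq.comp measurable_snd)).prodMk
      measurable_snd)).aemeasurable

/-- Finiteness of the Inverse Wishart normalizing constant for a scalar scale matrix, by induction
on the dimension. Integrating out the border lowers `ν` by one and leaves an inverse gamma integral
in the Schur complement, which converges because `ν > n`. -/
theorem lintegral_inverseWishartKernel_scalar_lt_top (n : ℕ) :
    ∀ {ν a : ℝ}, (n : ℝ) - 1 < ν → 0 < a →
      ∫⁻ S in {S | S.PosDef}, ENNReal.ofReal
        (inverseWishartKernel ν ((2 * a) • (1 : Matrix (Fin n) (Fin n) ℝ)) S)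
          ∂symmetricLebesgue n < ∞ := by
  induction n with
  | zero =>
    intro ν a _ _
    have h1 : ∀ S : Matrix (Fin 0) (Fin 0) ℝ, inverseWishartKernel ν
        ((2 * a) • (1 : Matrix (Fin 0) (Fin 0) ℝ)) S = 1 := fun S => by
      simp [inverseWishartKernel]
    simp only [h1, ENNReal.ofReal_one, lintegral_one, Measure.restrict_apply MeasurableSet.univ]
    refine (measure_mono (Set.subset_univ _)).trans_lt ?_
    rw [symmetricLebesgue, Measure.map_apply continuous_symmetricOfUpper.measurable
      MeasurableSet.univ, Set.preimage_univ, Measure.volume_pi_eq_dirac]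
    simp
  | succ n ih =>
    intro ν a hν ha
    push_cast at hν
    have hn : (0 : ℝ) ≤ n := n.cast_nonneg
    have hIH := ih (ν := ν - 1) (a := a) (by linarith) ha
    have hJ := lintegral_inverse_gamma_lt_top (s := ν / 2) (a := a) (by linarith) ha
    have hC := lintegral_exp_neg_mul_dotProduct_lt_top n ha
    -- `C` is the Gaussian integral over the border, `J` the inverse gamma integral over the
    -- Schur complement; the corner `A` contributes the integral for `n` and `ν - 1`.
    set C := ∫⁻ v : Fin n → ℝ, ENNReal.ofReal (Real.exp (-a * (v ⬝ᵥ v))) with hCdef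
    set J := ∫⁻ d in Set.Ioi (0 : ℝ), ENNReal.ofReal (d ^ (-(ν / 2) - 1) * Real.exp (-a * d⁻¹))
      with hJdef
    let k := inverseWishartKernel ν ((2 * a) • (1 : Matrix (Fin (n + 1)) (Fin (n + 1)) ℝ))
    have hk : Measurable fun S => ENNReal.ofReal (k S) :=
      (measurable_inverseWishartKernel _ _).ennreal_ofReal
    have hkey : ∀ A : Matrix (Fin n) (Fin n) ℝ,
        ∫⁻ d : ℝ, ∫⁻ b : Fin n → ℝ, ({S | S.PosDef}.indicator fun S => ENNReal.ofReal (k S))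
          (borderedMatrix A b (d + b ⬝ᵥ (A⁻¹ *ᵥ b))) ≤
        ({A | A.PosDef}.indicator fun A => ENNReal.ofReal (inverseWishartKernel (ν - 1)
          ((2 * a) • (1 : Matrix (Fin n) (Fin n) ℝ)) A)) A * (J * C) := by
      intro A
      by_cases hA : A.PosDef
      swap
      · have hb (b c) : ¬ (borderedMatrix A b c).PosDef := fun h => hA (posDef_of_borderedMatrix h)
        simp [hb]
      have hdet := hA.det_pos
      rw [Set.indicator_of_mem (by exact hA), hJdef, ← lintegral_mul_const _ (by fun_prop),
        ← lintegral_const_mul _ (by fun_prop), ← lintegral_indicator measurableSet_Ioi]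
      refine lintegral_mono fun d => ?_
      by_cases hd : 0 < d
      swap
      · have hb (b) : ¬ (borderedMatrix A b (d + b ⬝ᵥ (A⁻¹ *ᵥ b))).PosDef := fun h => by
          have := h.det_pos
          rw [det_borderedMatrix hdet.ne', add_sub_cancel_right] at this
          exact hd (pos_of_mul_pos_right this hdet.le)
        simp [hb]
      rw [Set.indicator_of_mem (by exact hd)]
      calc ∫⁻ b : Fin n → ℝ, ({S | S.PosDef}.indicator fun S => ENNReal.ofReal (k S))
            (borderedMatrix A b (d + b ⬝ᵥ (A⁻¹ *ᵥ b)))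
          ≤ ∫⁻ b : Fin n → ℝ, ENNReal.ofReal (k (borderedMatrix A b (d + b ⬝ᵥ (A⁻¹ *ᵥ b)))) :=
            lintegral_mono fun b => Set.indicator_le_self _ _ _
        _ = ENNReal.ofReal (A.det ^ (-(ν + n + 2) / 2) * Real.exp (-a * A⁻¹.trace) *
              (d ^ (-(ν + n + 2) / 2) * Real.exp (-a * d⁻¹))) *
            (ENNReal.ofReal (A.det * d ^ ((n : ℝ) / 2)) * C) := by
          rw [hCdef, ← lintegral_exp_neg_inv_mulVec hdet hd, ← lintegral_const_mul' _ _
            ENNReal.ofReal_ne_top]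
          refine lintegral_congr fun b => ?_
          rw [← ENNReal.ofReal_mul (by positivity)]
          simp only [k]
          rw [inverseWishartKernel_borderedMatrix hA b hd]
        _ = _ := by
          rw [← mul_assoc, ← mul_assoc (ENNReal.ofReal (inverseWishartKernel _ _ A)),
            ← ENNReal.ofReal_mul (by positivity),
            ← ENNReal.ofReal_mul (inverseWishartKernel_pos _ _ hA).le]
          congr 2
          have e1 : A.det ^ (-(ν - 1 + n + 1) / 2) = A.det ^ (-(ν + n + 2) / 2) * A.det := by
            conv_rhs => rw [← Real.rpow_add_one hdet.ne']
            congr 1; ring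
          have e2 : d ^ (-(ν / 2) - 1) = d ^ (-(ν + n + 2) / 2) * d ^ ((n : ℝ) / 2) := by
            rw [← Real.rpow_add hd]; congr 1; ring
          have e3 : -(1 / 2) * (((2 * a) • (1 : Matrix (Fin n) (Fin n) ℝ)) * A⁻¹).trace =
              -a * A⁻¹.trace := by
            rw [smul_mul_assoc, one_mul, Matrix.trace_smul, smul_eq_mul]; ring
          rw [inverseWishartKernel, e1, e2, e3]
          ring
    rw [← lintegral_indicator (measurableSet_posDef _),
      lintegral_symmetricLebesgue_succ (hk.indicator (measurableSet_posDef _))]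
    refine (lintegral_mono hkey).trans_lt ?_
    rw [lintegral_mul_const' _ _ (ENNReal.mul_lt_top hJ hC).ne,
      lintegral_indicator (measurableSet_posDef _)]
    exact ENNReal.mul_lt_top hIH (ENNReal.mul_lt_top hJ hC)

open scoped MatrixOrder in
theorem Matrix.PosDef.exists_smul_one_le {n : ℕ} {Ψ : Matrix (Fin n) (Fin n) ℝ} (hΨ : Ψ.PosDef) :
    ∃ a : ℝ, 0 < a ∧ (Ψ - a • (1 : Matrix (Fin n) (Fin n) ℝ)).PosSemidef := by
  obtain ⟨a, ha, h⟩ : ∃ a : ℝ, 0 < a ∧ ∀ i, a ≤ hΨ.1.eigenvalues i := by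
    rcases isEmpty_or_nonempty (Fin n) with _ | _
    · exact ⟨1, one_pos, isEmptyElim⟩
    · obtain ⟨i, hi⟩ := Finite.exists_min hΨ.1.eigenvalues
      exact ⟨_, hΨ.eigenvalues_pos i, hi⟩
  refine ⟨a, ha, ?_⟩
  have := (algebraMap_le_iff_le_spectrum (R := ℝ) (a := Ψ) (r := a) hΨ.1).2 (by
    rw [hΨ.1.spectrum_real_eq_range_eigenvalues]
    rintro _ ⟨i, rfl⟩
    exact h i)
  rwa [Algebra.algebraMap_eq_smul_one, Matrix.le_iff] at this

open scoped MatrixOrder in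
theorem Matrix.PosSemidef.trace_mul_nonneg {n : ℕ} {A B : Matrix (Fin n) (Fin n) ℝ}
    (hA : A.PosSemidef) (hB : B.PosSemidef) : 0 ≤ (A * B).trace := by
  have hR := (Matrix.nonneg_iff_posSemidef.1 (CFC.sqrt_nonneg A)).isHermitian
  have hRR : CFC.sqrt A * CFC.sqrt A = A := CFC.sqrt_mul_sqrt_self _ hA.nonneg
  rw [← hRR, Matrix.mul_assoc, Matrix.trace_mul_comm]
  have := (hB.mul_mul_conjTranspose_same (CFC.sqrt A)).trace_nonneg
  rwa [hR.eq] at this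

theorem inverseWishartUnnormalized_univ_lt_top {n : ℕ} {ν : ℝ} (hν : (n : ℝ) - 1 < ν)
    {Ψ : Matrix (Fin n) (Fin n) ℝ} (hΨ : Ψ.PosDef) :
    inverseWishartUnnormalized ν Ψ Set.univ < ∞ := by
  obtain ⟨a, ha, h⟩ := hΨ.exists_smul_one_le
  rw [inverseWishartUnnormalized_univ]
  -- Replacing `Ψ` by `a • 1 ≤ Ψ` can only increase the kernel, as `Tr((Ψ - a • 1) S⁻¹) ≥ 0`.
  refine lt_of_le_of_lt ?_ (lintegral_inverseWishartKernel_scalar_lt_top n hν (half_pos ha))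
  refine setLIntegral_mono' (measurableSet_posDef n) fun S hS => ENNReal.ofReal_le_ofReal ?_
  have hS : S.PosDef := hS
  have := h.trace_mul_nonneg hS.inv.posSemidef
  rw [sub_mul, Matrix.trace_sub] at this
  have hdet := hS.det_pos
  unfold inverseWishartKernel
  rw [mul_div_cancel₀ a two_ne_zero]
  gcongr ?_ * Real.exp ?_
  linarith

theorem isProbabilityMeasure_inverseWishart {n : ℕ} {ν : ℝ} (hν : (n : ℝ) - 1 < ν)
    {Ψ : Matrix (Fin n) (Fin n) ℝ} (hΨ : Ψ.PosDef) :
    IsProbabilityMeasure (inverseWishart ν Ψ) :=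
  ⟨by
    rw [inverseWishart, Measure.smul_apply, smul_eq_mul]
    exact ENNReal.inv_mul_cancel (inverseWishartUnnormalized_univ_ne_zero ν Ψ)
      (inverseWishartUnnormalized_univ_lt_top hν hΨ).ne⟩

/-! ### Conjugacy of the normal likelihood and the Inverse Wishart kernel -/

theorem scatterMatrix_posSemidef {n m : ℕ} (r : Fin m → EuclideanSpace ℝ (Fin n))
    (μ : EuclideanSpace ℝ (Fin n)) : (scatterMatrix r μ).PosSemidef := by
  refine Matrix.posSemidef_sum _ fun i _ => ?_
  simpa using Matrix.posSemidef_vecMulVec_self_star (r i - μ).ofLp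

theorem trace_scatterMatrix_mul {n m : ℕ} (r : Fin m → EuclideanSpace ℝ (Fin n))
    (μ : EuclideanSpace ℝ (Fin n)) (T : Matrix (Fin n) (Fin n) ℝ) :
    (scatterMatrix r μ * T).trace = ∑ i, (r i - μ).ofLp ⬝ᵥ (T *ᵥ (r i - μ).ofLp) := by
  rw [scatterMatrix, Finset.sum_mul, Matrix.trace_sum]
  refine Finset.sum_congr rfl fun i _ => ?_
  rw [Matrix.vecMulVec_mul, Matrix.trace_vecMulVec, Matrix.dotProduct_mulVec, dotProduct_comm]

theorem continuous_scatterMatrix (n m : ℕ) :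
    Continuous fun p : (Fin m → EuclideanSpace ℝ (Fin n)) × EuclideanSpace ℝ (Fin n) =>
      scatterMatrix p.1 p.2 := by
  refine continuous_finsetSum _ fun i _ => ?_
  exact Continuous.matrix_vecMulVec (by fun_prop) (by fun_prop)

theorem continuous_multivariateGaussianDensity {n : ℕ} (μ : EuclideanSpace ℝ (Fin n))
    (S : Matrix (Fin n) (Fin n) ℝ) : Continuous (multivariateGaussianDensity μ S) := by
  have h1 : Continuous fun x : EuclideanSpace ℝ (Fin n) => S⁻¹ *ᵥ (x - μ).ofLp :=
    Continuous.matrix_mulVec continuous_const (by fun_prop)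
  have h2 : Continuous fun x : EuclideanSpace ℝ (Fin n) =>
    (x - μ).ofLp ⬝ᵥ (S⁻¹ *ᵥ (x - μ).ofLp) := Continuous.dotProduct (by fun_prop) h1
  exact continuous_const.mul (h2.const_mul _).rexp

theorem multivariateGaussianDensity_nonneg {n : ℕ} (μ : EuclideanSpace ℝ (Fin n))
    {S : Matrix (Fin n) (Fin n) ℝ} (hS : S.PosDef) (x : EuclideanSpace ℝ (Fin n)) :
    0 ≤ multivariateGaussianDensity μ S x := by
  have := hS.det_pos
  unfold multivariateGaussianDensity
  positivity

theorem normalSample_eq_withDensity {n : ℕ} (m : ℕ) (μ : EuclideanSpace ℝ (Fin n))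
    {S : Matrix (Fin n) (Fin n) ℝ} (hS : S.PosDef) :
    normalSample m μ S = volume.withDensity fun r =>
      ENNReal.ofReal (∏ i, multivariateGaussianDensity μ S (r i)) := by
  rw [normalSample, multivariateGaussian_eq_withDensity μ hS, volume_pi,
    pi_withDensity_fin _ _ fun _ =>
      (continuous_multivariateGaussianDensity μ S).measurable.ennreal_ofReal]
  congr 1
  ext r
  exact (ENNReal.ofReal_prod_of_nonneg fun i _ =>
    multivariateGaussianDensity_nonneg μ hS _).symm

/-- Conjugacy at the level of densities: the likelihood of a normal sample times the Inverse
Wishart kernel is, as a function of `S`, a multiple of the updated Inverse Wishart kernel. -/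
theorem inverseWishartKernel_mul_prod_multivariateGaussianDensity {n m : ℕ} (ν : ℝ)
    (Ψ : Matrix (Fin n) (Fin n) ℝ) (r : Fin m → EuclideanSpace ℝ (Fin n))
    (μ : EuclideanSpace ℝ (Fin n)) {S : Matrix (Fin n) (Fin n) ℝ} (hS : S.PosDef) :
    inverseWishartKernel ν Ψ S * ∏ i, multivariateGaussianDensity μ S (r i) =
      ((√(2 * Real.pi))⁻¹ ^ n) ^ m * inverseWishartKernel (ν + m) (Ψ + scatterMatrix r μ) S := by
  have hdet := hS.det_pos
  simp only [multivariateGaussianDensity, inverseWishartKernel, Finset.prod_mul_distrib,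
    Finset.prod_const, Finset.card_univ, Fintype.card_fin, ← Real.exp_sum, ← Finset.mul_sum,
    add_mul, Matrix.trace_add, trace_scatterMatrix_mul, mul_add, Real.exp_add]
  rw [← Real.rpow_mul_natCast hdet.le]
  have : -(ν + m + n + 1) / 2 = -(ν + n + 1) / 2 + -(1 / 2) * (m : ℝ) := by ring
  rw [this, Real.rpow_add hdet]
  ring

section posterior

variable {n m : ℕ}

theorem isProbabilityMeasure_posterior (m : ℕ) {ν : ℝ} (hν : (n : ℝ) - 1 < ν)
    {Ψ : Matrix (Fin n) (Fin n) ℝ} (hΨ : Ψ.PosDef)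
    (p : (Fin m → EuclideanSpace ℝ (Fin n)) × EuclideanSpace ℝ (Fin n)) :
    IsProbabilityMeasure (inverseWishart (ν + m) (Ψ + scatterMatrix p.1 p.2)) :=
  isProbabilityMeasure_inverseWishart (by linarith [(m.cast_nonneg : (0 : ℝ) ≤ m)])
    (hΨ.add_posSemidef (scatterMatrix_posSemidef _ _))

theorem measurable_inverseWishart {α : Type*} [MeasurableSpace α] (ν : ℝ)
    {Ψ : α → Matrix (Fin n) (Fin n) ℝ} (hΨ : Measurable Ψ) :
    Measurable fun a => inverseWishart ν (Ψ a) := by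
  have h : Measurable fun a => inverseWishartUnnormalized ν (Ψ a) :=
    measurable_withDensity ((measurable_inverseWishartKernel_uncurry ν).comp
      (hΨ.prodMap measurable_id)).ennreal_ofReal
  refine Measure.measurable_of_measurable_coe _ fun s hs => ?_
  simp only [inverseWishart, Measure.smul_apply, smul_eq_mul]
  exact ((Measure.measurable_coe MeasurableSet.univ).comp h).inv.mul
    ((Measure.measurable_coe hs).comp h)

/-- The Inverse Wishart full conditional of the covariance matrix, as a kernel. -/
noncomputable def posteriorKernel (m : ℕ) (ν : ℝ) (Ψ : Matrix (Fin n) (Fin n) ℝ) :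
    Kernel ((Fin m → EuclideanSpace ℝ (Fin n)) × EuclideanSpace ℝ (Fin n))
      (Matrix (Fin n) (Fin n) ℝ) where
  toFun p := inverseWishart (ν + m) (Ψ + scatterMatrix p.1 p.2)
  measurable' := measurable_inverseWishart _
    (continuous_const.add (continuous_scatterMatrix n m)).measurable

theorem lintegral_inverseWishartUnnormalized (ν : ℝ) (Ψ : Matrix (Fin n) (Fin n) ℝ)
    (f : Matrix (Fin n) (Fin n) ℝ → ℝ≥0∞) :
    ∫⁻ S, f S ∂inverseWishartUnnormalized ν Ψ =
      ∫⁻ S in {S | S.PosDef}, ENNReal.ofReal (inverseWishartKernel ν Ψ S) * f S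
        ∂symmetricLebesgue n :=
  lintegral_withDensity_eq_lintegral_mul_non_measurable _
    (measurable_inverseWishartKernel ν Ψ).ennreal_ofReal
    (ae_of_all _ fun _ => ENNReal.ofReal_lt_top) f

theorem lintegral_inverseWishart_eq (ν : ℝ) (Ψ : Matrix (Fin n) (Fin n) ℝ)
    (f : Matrix (Fin n) (Fin n) ℝ → ℝ≥0∞) :
    ∫⁻ S, f S ∂inverseWishart ν Ψ = (inverseWishartUnnormalized ν Ψ Set.univ)⁻¹ *
      ∫⁻ S, f S ∂inverseWishartUnnormalized ν Ψ := by
  rw [inverseWishart, lintegral_smul_measure, smul_eq_mul]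

/-! ### The full conditional of the covariance matrix -/

/-- Bayes' formula for a fixed mean `μ`: integrating first over the sample and then over the prior
of the covariance matrix is the same as integrating first over the full conditional of the
covariance matrix and then over the marginal density of the sample. That density is, up to a
constant, the ratio of the normalizing constants of the two Inverse Wishart distributions. -/
theorem lintegral_inverseWishart_lintegral_normalSample {ν : ℝ} (hν : (n : ℝ) - 1 < ν)
    {Ψ : Matrix (Fin n) (Fin n) ℝ} (hΨ : Ψ.PosDef) (μ : EuclideanSpace ℝ (Fin n))
    {f : ((Fin m → EuclideanSpace ℝ (Fin n)) × EuclideanSpace ℝ (Fin n)) ×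
      Matrix (Fin n) (Fin n) ℝ → ℝ≥0∞} (hf : Measurable f) :
    ∫⁻ S, (∫⁻ r, f ((r, μ), S) ∂normalSample m μ S) ∂inverseWishart ν Ψ =
      ∫⁻ r : Fin m → EuclideanSpace ℝ (Fin n),
        (inverseWishartUnnormalized ν Ψ Set.univ)⁻¹ *
        ENNReal.ofReal (((√(2 * Real.pi))⁻¹ ^ n) ^ m) *
        inverseWishartUnnormalized (ν + m) (Ψ + scatterMatrix r μ) Set.univ *
        ∫⁻ S, f ((r, μ), S) ∂inverseWishart (ν + m) (Ψ + scatterMatrix r μ) := by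
  have hr : ∀ r : Fin m → EuclideanSpace ℝ (Fin n),
      inverseWishartUnnormalized (ν + m) (Ψ + scatterMatrix r μ) Set.univ *
        ∫⁻ S, f ((r, μ), S) ∂inverseWishart (ν + m) (Ψ + scatterMatrix r μ) =
      ∫⁻ S in {S | S.PosDef}, ENNReal.ofReal
        (inverseWishartKernel (ν + m) (Ψ + scatterMatrix r μ) S) * f ((r, μ), S)
        ∂symmetricLebesgue n := by
    intro r
    rw [lintegral_inverseWishart_eq, ← mul_assoc, ENNReal.mul_inv_cancel
      (inverseWishartUnnormalized_univ_ne_zero _ _)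
      (inverseWishartUnnormalized_univ_lt_top
        (by linarith [(m.cast_nonneg : (0 : ℝ) ≤ m)])
        (hΨ.add_posSemidef (scatterMatrix_posSemidef _ _))).ne,
      one_mul, lintegral_inverseWishartUnnormalized]
  have hΨ' : Measurable fun p : Matrix (Fin n) (Fin n) ℝ × (Fin m → EuclideanSpace ℝ (Fin n)) =>
      Ψ + scatterMatrix p.2 μ :=
    ((continuous_const.add ((continuous_scatterMatrix n m).comp
      (continuous_id.prodMk continuous_const))).measurable).comp measurable_snd
  have hmeas : Measurable fun p : Matrix (Fin n) (Fin n) ℝ × (Fin m → EuclideanSpace ℝ (Fin n)) =>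
      ENNReal.ofReal (inverseWishartKernel (ν + m) (Ψ + scatterMatrix p.2 μ) p.1) *
        f ((p.2, μ), p.1) :=
    (((measurable_inverseWishartKernel_uncurry (ν + m)).comp
      (hΨ'.prodMk measurable_fst)).ennreal_ofReal).mul
      (hf.comp ((measurable_snd.prodMk measurable_const).prodMk measurable_fst))
  simp_rw [mul_assoc _ (inverseWishartUnnormalized (ν + m) _ _), hr]
  rw [lintegral_inverseWishart_eq, lintegral_inverseWishartUnnormalized,
    lintegral_const_mul' _ _ (ENNReal.mul_ne_top (ENNReal.inv_ne_top.2
      (inverseWishartUnnormalized_univ_ne_zero _ _)) ENNReal.ofReal_ne_top), mul_assoc,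
    lintegral_lintegral_swap (f := fun r S => ENNReal.ofReal
      (inverseWishartKernel (ν + m) (Ψ + scatterMatrix r μ) S) * f ((r, μ), S))
      (hmeas.comp measurable_swap).aemeasurable,
    ← lintegral_const_mul' _ _ ENNReal.ofReal_ne_top]
  congr 1
  refine setLIntegral_congr_fun (measurableSet_posDef n) fun S hS => ?_
  have hS : S.PosDef := hS
  have hg : Measurable fun r : Fin m → EuclideanSpace ℝ (Fin n) =>
      ENNReal.ofReal (∏ i, multivariateGaussianDensity μ S (r i)) :=
    (continuous_finsetProd _ fun i _ => (continuous_multivariateGaussianDensity μ S).comp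
      (continuous_apply i)).measurable.ennreal_ofReal
  rw [normalSample_eq_withDensity m μ hS, lintegral_withDensity_eq_lintegral_mul_non_measurable _ hg
      (ae_of_all _ fun _ => ENNReal.ofReal_lt_top),
    ← lintegral_const_mul' _ _ ENNReal.ofReal_ne_top,
    ← lintegral_const_mul' _ _ ENNReal.ofReal_ne_top]
  refine lintegral_congr fun r => ?_
  rw [Pi.mul_apply, ← mul_assoc, ← mul_assoc,
    ← ENNReal.ofReal_mul (inverseWishartKernel_pos _ _ hS).le, ← ENNReal.ofReal_mul (by positivity),
    inverseWishartKernel_mul_prod_multivariateGaussianDensity _ _ _ _ hS]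

/-- The full conditional of the covariance matrix is Inverse Wishart for every `σ`-finite prior on
the mean, proper or not. -/
theorem hasConditionalLaw_inverseWishart {ν : ℝ} (hν : (n : ℝ) - 1 < ν)
    {Ψ : Matrix (Fin n) (Fin n) ℝ} (hΨ : Ψ.PosDef) {X : Type*} [MeasurableSpace X] {Pr : Measure X}
    {r : X → Fin m → EuclideanSpace ℝ (Fin n)} {μ : X → EuclideanSpace ℝ (Fin n)}
    {S : X → Matrix (Fin n) (Fin n) ℝ}
    (hr : HasConditionalLaw r (fun x => (μ x, S x)) (fun p => normalSample m p.1 p.2) Pr)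
    (ρ : Measure (EuclideanSpace ℝ (Fin n))) [SigmaFinite ρ]
    (hlaw : HasLaw (fun x => (μ x, S x)) (ρ.prod (inverseWishart ν Ψ)) Pr) :
    HasConditionalLaw S (fun x => (r x, μ x))
      (fun p => inverseWishart (ν + m) (Ψ + scatterMatrix p.1 p.2)) Pr := by
  have : IsMarkovKernel (posteriorKernel m ν Ψ) := ⟨isProbabilityMeasure_posterior m hν hΨ⟩
  have := isProbabilityMeasure_inverseWishart hν hΨ
  obtain ⟨-, κ, hκ, hκae, hcond⟩ := hr
  rw [hlaw.map_eq] at hκae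
  have hrm : AEMeasurable r Pr := hcond.aemeasurable_snd
  have hμm : AEMeasurable μ Pr := hlaw.aemeasurable.fst
  have hSm : AEMeasurable S Pr := hlaw.aemeasurable.snd
  -- The law of `(r, μ)` is `σ`-finite because its marginal `ρ` is.
  have hσ : SigmaFinite (Pr.map fun x => (r x, μ x)) := by
    refine SigmaFinite.of_map _ (f := Prod.snd) measurable_snd.aemeasurable ?_
    have h1 : (Pr.map fun x => (r x, μ x)).map Prod.snd = ρ := by
      rw [AEMeasurable.map_map_of_aemeasurable measurable_snd.aemeasurable (hrm.prodMk hμm)]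
      change Pr.map (Prod.fst ∘ fun x => (μ x, S x)) = ρ
      rw [← AEMeasurable.map_map_of_aemeasurable measurable_fst.aemeasurable hlaw.aemeasurable,
        hlaw.map_eq]
      exact Measure.fst_prod
    rwa [h1]
  -- `w` is the density of the law of `(r, μ)` with respect to `volume.prod ρ`.
  let w : (Fin m → EuclideanSpace ℝ (Fin n)) × EuclideanSpace ℝ (Fin n) → ℝ≥0∞ := fun p =>
    (inverseWishartUnnormalized ν Ψ Set.univ)⁻¹ *
      ENNReal.ofReal (((√(2 * Real.pi))⁻¹ ^ n) ^ m) *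
      inverseWishartUnnormalized (ν + m) (Ψ + scatterMatrix p.1 p.2) Set.univ
  have hw : Measurable w := by
    refine Measurable.const_mul ?_ _
    exact (Measure.measurable_coe MeasurableSet.univ).comp (measurable_withDensity
      ((measurable_inverseWishartKernel_uncurry (ν + m)).comp
        (((continuous_const.add (continuous_scatterMatrix n m)).measurable).prodMap
          measurable_id)).ennreal_ofReal)
  let η := ((volume : Measure (Fin m → EuclideanSpace ℝ (Fin n))).prod ρ).withDensity w
  -- Tonelli and Bayes' formula for each fixed mean.
  have hJ : Pr.map (fun x => ((r x, μ x), S x)) = η ⊗ₘ posteriorKernel m ν Ψ := by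
    refine Measure.ext_of_lintegral _ fun f hf => ?_
    let σ : (EuclideanSpace ℝ (Fin n) × Matrix (Fin n) (Fin n) ℝ) ×
        (Fin m → EuclideanSpace ℝ (Fin n)) →
        ((Fin m → EuclideanSpace ℝ (Fin n)) × EuclideanSpace ℝ (Fin n)) ×
          Matrix (Fin n) (Fin n) ℝ := fun p => ((p.2, p.1.1), p.1.2)
    have hσm : Measurable σ := by fun_prop
    have hmap : Pr.map (fun x => ((r x, μ x), S x)) =
        ((ρ.prod (inverseWishart ν Ψ)) ⊗ₘ κ).map σ := by
      rw [← hlaw.map_eq, ← hcond.map_eq,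
        AEMeasurable.map_map_of_aemeasurable hσm.aemeasurable hcond.aemeasurable]
      rfl
    have hin : Measurable fun p : EuclideanSpace ℝ (Fin n) × Matrix (Fin n) (Fin n) ℝ =>
        ∫⁻ r, f ((r, p.1), p.2) ∂κ p := (hf.comp hσm).lintegral_kernel_prod_right'
    have hpost : Measurable fun p => ∫⁻ S, f (p, S) ∂posteriorKernel m ν Ψ p :=
      hf.lintegral_kernel_prod_right'
    rw [hmap, lintegral_map hf hσm]
    refine (Measure.lintegral_compProd (hf.comp hσm)).trans ?_
    rw [Measure.lintegral_compProd hf,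
      lintegral_withDensity_eq_lintegral_mul _ hw hpost,
      lintegral_prod_symm _ (hw.mul hpost).aemeasurable]
    refine (lintegral_prod _ hin.aemeasurable).trans ?_
    refine lintegral_congr_ae ?_
    filter_upwards [Measure.ae_ae_of_ae_prod hκae] with μ₀ hμ₀
    calc ∫⁻ S, (∫⁻ r, f ((r, μ₀), S) ∂κ (μ₀, S)) ∂inverseWishart ν Ψ
        = ∫⁻ S, (∫⁻ r, f ((r, μ₀), S) ∂normalSample m μ₀ S) ∂inverseWishart ν Ψ := by
          refine lintegral_congr_ae ?_
          filter_upwards [hμ₀] with S₁ hS₁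
          rw [hS₁]
      _ = _ := lintegral_inverseWishart_lintegral_normalSample hν hΨ μ₀ hf
  -- Since the kernel is Markov, `η` is the first marginal of the joint law.
  have hη : Pr.map (fun x => (r x, μ x)) = η := by
    rw [← Measure.fst_compProd η (posteriorKernel m ν Ψ), ← hJ, Measure.fst_map_prodMk₀ hSm]
  exact ⟨hσ, posteriorKernel m ν Ψ, inferInstance, ae_of_all _ fun _ => rfl,
    (hrm.prodMk hμm).prodMk hSm, by rw [hJ, hη]⟩

/-! ### Normal samples under invertible linear maps -/

theorem continuous_applyMatrix {k : ℕ} (P : Matrix (Fin k) (Fin n) ℝ) :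
    Continuous (applyMatrix P) :=
  (PiLp.continuous_toLp 2 _).comp (Continuous.matrix_mulVec continuous_const (by fun_prop))

theorem applyMatrix_mul_cancel {P Q : Matrix (Fin n) (Fin n) ℝ} (h : P * Q = 1)
    (x : EuclideanSpace ℝ (Fin n)) : applyMatrix P (applyMatrix Q x) = x := by
  simp [applyMatrix, h]

theorem map_applyMatrix_multivariateGaussian {Q : Matrix (Fin n) (Fin n) ℝ} (hQ : IsUnit Q.det)
    (μ : EuclideanSpace ℝ (Fin n)) (S : Matrix (Fin n) (Fin n) ℝ) :
    (multivariateGaussian μ S).map (applyMatrix Q) =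
      multivariateGaussian (applyMatrix Q μ) (Q * S * Qᵀ) := by
  have hQm := (continuous_applyMatrix Q).measurable
  by_cases hS : S.PosSemidef
  · have hS' : (Q * S * Qᵀ).PosSemidef := by simpa using hS.mul_mul_conjTranspose_same Q
    have := Measure.isProbabilityMeasure_map (μ := multivariateGaussian μ S) hQm.aemeasurable
    refine Measure.ext_of_charFun (E := EuclideanSpace ℝ (Fin n)) ?_
    ext t
    have hinner (x : EuclideanSpace ℝ (Fin n)) :
        inner ℝ (applyMatrix Q x) t = inner ℝ x (applyMatrix Qᵀ t) := by
      simp only [EuclideanSpace.inner_eq_star_dotProduct, applyMatrix, star_trivial]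
      rw [Matrix.mulVec_transpose, Matrix.dotProduct_mulVec]
    have h1 : charFun ((multivariateGaussian μ S).map (applyMatrix Q)) t =
        charFun (multivariateGaussian μ S) (applyMatrix Qᵀ t) := by
      rw [charFun_apply, charFun_apply, integral_map hQm.aemeasurable (by fun_prop)]
      simp_rw [hinner]
    rw [h1, charFun_multivariateGaussian hS, charFun_multivariateGaussian hS', real_inner_comm,
      ← hinner, real_inner_comm]
    congr 4
    simp only [applyMatrix]
    rw [Matrix.mulVec_transpose, ← Matrix.dotProduct_mulVec, Matrix.mulVec_mulVec,
      ← Matrix.mulVec_transpose, Matrix.mulVec_mulVec, Matrix.mul_assoc]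
  · -- Without positive semidefiniteness both sides are Dirac masses.
    have hS' : ¬ (Q * S * Qᵀ).PosSemidef := fun h => hS (by
      have := h.mul_mul_conjTranspose_same Q⁻¹
      rwa [Matrix.conjTranspose_eq_transpose_of_trivial, ← Matrix.mul_assoc, ← Matrix.mul_assoc,
        Matrix.nonsing_inv_mul _ hQ, Matrix.one_mul, Matrix.mul_assoc, ← Matrix.transpose_mul,
        Matrix.nonsing_inv_mul _ hQ, Matrix.transpose_one, Matrix.mul_one] at this)
    rw [multivariateGaussian_of_not_posSemidef _ hS, multivariateGaussian_of_not_posSemidef _ hS',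
      Measure.map_dirac' hQm]

theorem map_applyMatrix_normalSample {Q : Matrix (Fin n) (Fin n) ℝ} (hQ : IsUnit Q.det)
    (μ : EuclideanSpace ℝ (Fin n)) (S : Matrix (Fin n) (Fin n) ℝ) :
    (normalSample m μ S).map (fun r i => applyMatrix Q (r i)) =
      normalSample m (applyMatrix Q μ) (Q * S * Qᵀ) := by
  rw [normalSample, normalSample, ← map_applyMatrix_multivariateGaussian hQ]
  have := Measure.isProbabilityMeasure_map (μ := multivariateGaussian μ S)
    (continuous_applyMatrix Q).measurable.aemeasurable
  exact (Measure.pi_map_pi (μ := fun _ : Fin m => multivariateGaussian μ S) fun _ =>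
    (continuous_applyMatrix Q).measurable.aemeasurable)

/-- The change of coordinates `(μ, S) ↦ (Q μ, Q S Qᵀ)` is invertible, so conditioning on the
transformed parameters is the same as conditioning on the original ones. -/
theorem hasConditionalLaw_normalSample_applyMatrix {X : Type*} [MeasurableSpace X]
    {Pr : Measure X} [IsFiniteMeasure Pr]
    {r : X → Fin m → EuclideanSpace ℝ (Fin n)} {μ : X → EuclideanSpace ℝ (Fin n)}
    {S : X → Matrix (Fin n) (Fin n) ℝ}
    (hr : HasConditionalLaw r (fun x => (μ x, S x)) (fun p => normalSample m p.1 p.2) Pr)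
    {Q : Matrix (Fin n) (Fin n) ℝ} (hQ : IsUnit Q.det) :
    HasConditionalLaw (fun x i => applyMatrix Q (r x i))
      (fun x => (applyMatrix Q (μ x), Q * S x * Qᵀ)) (fun p => normalSample m p.1 p.2) Pr := by
  obtain ⟨-, κ, hκ, hκae, hcond⟩ := hr
  let F (P : Matrix (Fin n) (Fin n) ℝ) (p : EuclideanSpace ℝ (Fin n) × Matrix (Fin n) (Fin n) ℝ) :
    EuclideanSpace ℝ (Fin n) × Matrix (Fin n) (Fin n) ℝ := (applyMatrix P p.1, P * p.2 * Pᵀ)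
  have hF (P) : Measurable (F P) :=
    (continuous_applyMatrix P).measurable.prodMap
      ((continuous_const.mul continuous_id).mul continuous_const).measurable
  have hcancel {P R : Matrix (Fin n) (Fin n) ℝ} (h : P * R = 1) (p) : F P (F R p) = p := by
    refine Prod.ext (applyMatrix_mul_cancel h _) ?_
    change P * (R * p.2 * Rᵀ) * Pᵀ = p.2
    rw [← Matrix.mul_assoc, ← Matrix.mul_assoc, h, Matrix.one_mul, Matrix.mul_assoc,
      ← Matrix.transpose_mul, h, Matrix.transpose_one, Matrix.mul_one]
  have h1 := Matrix.nonsing_inv_mul _ hQ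
  have h2 := Matrix.mul_nonsing_inv _ hQ
  have hT : Measurable fun (r : Fin m → EuclideanSpace ℝ (Fin n)) i => applyMatrix Q (r i) :=
    measurable_pi_lambda _ fun i => (continuous_applyMatrix Q).measurable.comp
      (measurable_pi_apply i)
  have hκeq : (κ.comap (F Q⁻¹) (hF _)).comap (F Q) (hF _) = κ := by
    ext1 p
    rw [Kernel.comap_apply, Kernel.comap_apply, hcancel h1]
  have hmap : (Pr.map (F Q ∘ fun x => (μ x, S x))).map (F Q⁻¹) =
      Pr.map fun x => (μ x, S x) := by
    rw [AEMeasurable.map_map_of_aemeasurable (hF _).aemeasurable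
      ((hF Q).comp_aemeasurable hcond.aemeasurable_fst)]
    congr 1
    ext1 x
    exact hcancel h1 _
  rw [← hmap] at hκae
  refine ⟨inferInstance, (κ.comap (F Q⁻¹) (hF _)).map fun r i => applyMatrix Q (r i),
    Kernel.IsMarkovKernel.map _ hT, ?_, ?_⟩
  · filter_upwards [ae_of_ae_map (hF _).aemeasurable hκae] with p hp
    rw [Kernel.map_apply _ hT, Kernel.comap_apply, hp, map_applyMatrix_normalSample hQ]
    change normalSample m (F Q (F Q⁻¹ p)).1 (F Q (F Q⁻¹ p)).2 = _
    rw [hcancel h2]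
  · have : HasCondDistrib r (F Q ∘ fun x => (μ x, S x)) (κ.comap (F Q⁻¹) (hF _)) Pr :=
      HasCondDistrib.comp_right (hf := hF Q) (by rwa [hκeq])
    exact this.comp_left hT

end posterior

theorem mainTheorem2 (n m : ℕ) (ν : ℝ) (hν : (n : ℝ) - 1 < ν)
    (S₀ : Matrix (Fin n) (Fin n) ℝ) (hS₀ : S₀.PosDef)
    {X : Type*} [MeasurableSpace X] (Pr : Measure X)
    (r : X → Fin m → EuclideanSpace ℝ (Fin n))
    (μ : X → EuclideanSpace ℝ (Fin n)) (S : X → Matrix (Fin n) (Fin n) ℝ)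
    (hr : HasConditionalLaw r (fun x => (μ x, S x)) (fun p => normalSample m p.1 p.2) Pr) :
    -- the transformed model, with an invertible `Q` (the augmented view matrix)
    (∀ (Q : Matrix (Fin n) (Fin n) ℝ) (q : EuclideanSpace ℝ (Fin n))
      (W : Matrix (Fin n) (Fin n) ℝ)
      (r' : X → Fin m → EuclideanSpace ℝ (Fin n))
      (μ' : X → EuclideanSpace ℝ (Fin n)) (S' : X → Matrix (Fin n) (Fin n) ℝ),
      IsUnit Q.det → W.PosDef →
      (∀ x i, r' x i = applyMatrix Q (r x i)) →
      (∀ x, μ' x = applyMatrix Q (μ x)) →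
      (∀ x, S' x = Q * S x * Qᵀ) →
      HasLaw (fun x => (μ' x, S' x))
        ((multivariateGaussian q W).prod (inverseWishart ν S₀)) Pr →
      HasConditionalLaw r' (fun x => (μ' x, S' x)) (fun p => normalSample m p.1 p.2) Pr ∧
      HasConditionalLaw S' (fun x => (r' x, μ' x))
        (fun p => inverseWishart (ν + m) (S₀ + scatterMatrix p.1 p.2)) Pr) ∧
    -- the untransformed model, with any proper prior on `μ` for which `P μ ∼ N_k(q, W)`
    (∀ (k : ℕ) (P : Matrix (Fin k) (Fin n) ℝ) (q : EuclideanSpace ℝ (Fin k))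
      (W : Matrix (Fin k) (Fin k) ℝ) (ρ : Measure (EuclideanSpace ℝ (Fin n))),
      W.PosDef → IsProbabilityMeasure ρ →
      ρ.map (applyMatrix P) = multivariateGaussian q W →
      HasLaw (fun x => (μ x, S x)) (ρ.prod (inverseWishart ν S₀)) Pr →
      HasConditionalLaw S (fun x => (r x, μ x))
        (fun p => inverseWishart (ν + m) (S₀ + scatterMatrix p.1 p.2)) Pr) ∧
    -- the untransformed model, with the density `exp(-(Pμ - q)ᵀ W⁻¹ (Pμ - q)/2)` as prior on `μ`
    (∀ (k : ℕ) (P : Matrix (Fin k) (Fin n) ℝ) (q : EuclideanSpace ℝ (Fin k))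
      (W : Matrix (Fin k) (Fin k) ℝ),
      W.PosDef →
      HasLaw (fun x => (μ x, S x)) ((viewDensityPrior P q W).prod (inverseWishart ν S₀)) Pr →
      HasConditionalLaw S (fun x => (r x, μ x))
        (fun p => inverseWishart (ν + m) (S₀ + scatterMatrix p.1 p.2)) Pr) := by
  refine ⟨fun Q q W r' μ' S' hQ _ hr' hμ' hS' hlaw => ?_,
    fun k P q W ρ _ _ _ hlaw => hasConditionalLaw_inverseWishart hν hS₀ hr ρ hlaw,
    fun k P q W _ hlaw => ?_⟩
  · obtain rfl : r' = fun x i => applyMatrix Q (r x i) := funext fun x => funext (hr' x)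
    obtain rfl : μ' = fun x => applyMatrix Q (μ x) := funext hμ'
    obtain rfl : S' = fun x => Q * S x * Qᵀ := funext hS'
    have := isProbabilityMeasure_inverseWishart hν hS₀
    have := hlaw.isFiniteMeasure
    have h := hasConditionalLaw_normalSample_applyMatrix hr hQ
    exact ⟨h, hasConditionalLaw_inverseWishart hν hS₀ h _ hlaw⟩
  · have : SigmaFinite (viewDensityPrior P q W) := by
      unfold viewDensityPrior; infer_instance
    exact hasConditionalLaw_inverseWishart hν hS₀ hr _ hlaw
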